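/- **Wasserstein classifiers are optimally robust.** Let $\mathcal X\subset\mathbb R^n$ be compact, with the Euclidean distance, and let $P$ and $Q$ be Borel probability measures on $\mathcal X$ (the input distributions of the classes $+1$ and $-1$). Let $\mathrm{Lip}_1(\mathcal X,\mathbb R)$ be the set of $1$-Lipschitz functions $f:\mathcal X\to\mathbb R$. For a probability measure $M$ on $\mathcal X$ and $y\in\{-1,+1\}$ the mean certifiable robustness of $f$ is $$\mathcal R_{(M,y)}(f)=\mathbb E_{x\sim M}\big[\mathbf 1\{yf(x)>0\}|f(x)|\big]+\mathbb E_{x\sim M}\big[-\mathbf 1\{yf(x)<0\}|f(x)|\big],$$ the loss is $\mathcal L^W(f(x),y)=-yf(x)$, and $$\mathcal W_1(P,Q)=\inf_{\pi}\int\|x-z\|_2\,d\pi(x,z),$$ where $\pi$ ranges over the measures on $\mathcal X\times\mathcal X$ with marginals $P$ and $Q$. Then $\mathcal W_1(P,Q)$ is finite, the following maximum and minimum are attained, and $$\max_{f\in\mathrm{Lip}_1(\mathcal X,\mathbb R)}\big(\mathcal R_{(P,+1)}(f)+\mathcal R_{(Q,-1)}(f)\big)=-\min_{f\in\mathrm{Lip}_1(\mathcal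 X,\mathbb R)}\big(\mathbb E_{x\sim P}[\mathcal L^W(f(x),+1)]+\mathbb E_{x\sim Q}[\mathcal L^W(f(x),-1)]\big)=\mathcal W_1(P,Q).$$ Moreover, a function in $\mathrm{Lip}_1(\mathcal X,\mathbb R)$ attains the maximum if and only if it attains the minimum. If $\mathbb P_{XY}$ is any probability measure on $\mathcal X\times\{-1,+1\}$ with balanced classes, $\mathbb P(Y=1)=\tfrac12$, and with $P$ and $Q$ as the conditional laws of $X$ given $Y=+1$ and $Y=-1$, then also $$\min_{f\in\mathrm{Lip}_1(\mathcal X,\mathbb R)}\mathbb E_{(x,y)\sim\mathbb P_{XY}}[\mathcal L^W(f(x),y)]=-\tfrac12\,\mathcal W_1(P,Q),$$ the minimum is attained, and its minimizers in $\mathrm{Lip}_1(\mathcal X,\mathbb R)$ are exactly the maximizers in $\mathrm{Lip}_1(\mathcal X,\mathbb R)$ of $\mathcal R_{(P,+1)}+\mathcal R_{(Q,-1)}$. -/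

import Mathlib

open MeasureTheory

noncomputable section

namespace LipClass

/-- The label set `{-1, +1}`. -/
def labels : Set ℝ := {-1, 1}

/-- The set of `1`-Lipschitz real functions on a metric space `X`. -/
def lip1 (X : Type*) [PseudoEMetricSpace X] : Set (X → ℝ) := {f | LipschitzWith 1 f}

/-- The mean certifiable robustness of `f` on the distribution `P` with label `y`: the
certificate `|f x|` counts positively on well classified points and negatively on misclassified
ones. -/
def mcr {X : Type*} [MeasurableSpace X] (P : Measure X) (y : ℝ) (f : X → ℝ) : ℝ :=
  (∫ x, Set.indicator {x | 0 < y * f x} (fun x => |f x|) x ∂P) +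
    ∫ x, -Set.indicator {x | y * f x < 0} (fun x => |f x|) x ∂P

/-- The total robustness: `P` is the class of label `+1` and `Q` the class of label `-1`. -/
def totalMcr {X : Type*} [MeasurableSpace X] (P Q : Measure X) (f : X → ℝ) : ℝ :=
  mcr P 1 f + mcr Q (-1) f

/-- The loss of the prediction `t` for the label `y`. -/
def wLoss (t y : ℝ) : ℝ := -y * t

/-- The loss of `f` over the two classes: the sum of the expected losses on each class. -/
def classLoss {X : Type*} [MeasurableSpace X] (P Q : Measure X) (f : X → ℝ) : ℝ :=
  (∫ x, wLoss (f x) 1 ∂P) + ∫ x, wLoss (f x) (-1) ∂Q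

/-- The expected loss of `f` under a joint law of inputs and labels. -/
def expectedLoss {X : Type*} [MeasurableSpace X] (μ : Measure (X × labels)) (f : X → ℝ) : ℝ :=
  ∫ z, wLoss (f z.1) z.2 ∂μ

/-- The law of the input conditionally on the label being `y`. -/
def classLaw {X : Type*} [MeasurableSpace X] (μ : Measure (X × labels)) (y : ℝ) : Measure X :=
  (ProbabilityTheory.cond μ {z | (z.2 : ℝ) = y}).map Prod.fst

/-- The couplings of `P` and `Q`: measures on the product with marginals `P` and `Q`. -/
def couplings {X : Type*} [MeasurableSpace X] (P Q : Measure X) : Set (Measure (X × X)) :=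
  {π | π.map Prod.fst = P ∧ π.map Prod.snd = Q}

/-- The Wasserstein-1 distance, as an extended nonnegative real. -/
def wasserstein1 {X : Type*} [PseudoEMetricSpace X] [MeasurableSpace X] (P Q : Measure X) :
    ENNReal :=
  ⨅ π ∈ couplings P Q, ∫⁻ z, edist z.1 z.2 ∂π

end LipClass

end

noncomputable section

namespace LipClass

/-! Sign by sign the robustness integrand equals y f(x), so on `lip1 X` the total robustness is the
linear functional `meanGap`; the class loss is its negative, and the balanced expected loss is minus
half of it. Everything thus reduces to Kantorovich–Rubinstein duality with an attained maximum.

The maximum exists by Arzelà–Ascoli (`exists_isMaxOn_meanGap`), and integrating f x - f z ≤ dist x z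
bounds it by every transport cost (`meanGap_le_integral_dist`). Conversely, the infimum of ∫ φ dP +
∫ ψ dQ over φ x + ψ y ≥ h (x, y) is sublinear in h. Hahn–Banach gives a linear functional below it
with equality at minus the distance; Riesz makes this a measure, its marginals are P and Q, and the
c-transform bounds its cost by the maximum (`exists_coupling_integral_dist_le`). -/

/-! ### Hahn–Banach and Riesz representation. -/

/-- A sublinear functional dominates a linear functional with the same value at a given vector. -/
theorem exists_linearMap_le_sublinear_eq {E : Type*} [AddCommGroup E] [Module ℝ E] (N : E → ℝ)
    (N_hom : ∀ c : ℝ, 0 < c → ∀ x, N (c • x) = c * N x)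
    (N_add : ∀ x y, N (x + y) ≤ N x + N y) (v : E) :
    ∃ g : E →ₗ[ℝ] ℝ, g v = N v ∧ ∀ x, g x ≤ N x := by
  have N0 : N 0 = 0 := by
    have := N_hom 2 (by norm_num) 0
    rw [smul_zero] at this
    linarith
  have H : ∀ c : ℝ, c • v = 0 → (RingHom.id ℝ) c • N v = 0 := by
    intro c hc
    rcases smul_eq_zero.1 hc with h | h
    · simp [h]
    · simp [h, N0]
  obtain ⟨g, hg, hgN⟩ := exists_extension_of_le_sublinear
    (LinearPMap.mkSpanSingleton' v (N v) H) N N_hom N_add (by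
      rintro ⟨x, hx⟩
      obtain ⟨c, rfl⟩ := Submodule.mem_span_singleton.1 hx
      rw [LinearPMap.mkSpanSingleton'_apply]
      simp only [RingHom.id_apply, smul_eq_mul]
      rcases lt_trichotomy c 0 with h | h | h
      -- Homogeneity covers only positive scalars; for c < 0 use 0 = N 0 ≤ N (c v) + N (-c v).
      · have h1 := N_hom (-c) (by linarith) v
        have h2 := N_add (c • v) (-c • v)
        rw [← add_smul, add_neg_cancel, zero_smul, N0, h1] at h2
        linarith
      · simp [h, N0]
      · exact (N_hom c h v).ge)
  refine ⟨g, ?_, hgN⟩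
  exact (hg ⟨v, Submodule.mem_span_singleton_self v⟩).trans
    (LinearPMap.mkSpanSingleton'_apply_self _ _ _ _)

/-- Every positive linear functional on the continuous functions of a compact space is the
integral against a finite measure. -/
theorem exists_measure_integral_eq_of_nonneg {K : Type*} [TopologicalSpace K] [CompactSpace K]
    [T2Space K] [MeasurableSpace K] [BorelSpace K] (Λ : C(K, ℝ) →ₗ[ℝ] ℝ)
    (hΛ : ∀ h : C(K, ℝ), (∀ z, 0 ≤ h z) → 0 ≤ Λ h) :
    ∃ μ : Measure K, IsFiniteMeasure μ ∧ ∀ h : C(K, ℝ), ∫ z, h z ∂μ = Λ h := by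
  let L : CompactlySupportedContinuousMap K ℝ →ₚ[ℝ] ℝ := PositiveLinearMap.mk₀
    { toFun := fun h => Λ h.toContinuousMap
      map_add' := fun f g => Λ.map_add f.toContinuousMap g.toContinuousMap
      map_smul' := fun c f => Λ.map_smul c f.toContinuousMap } (fun h hh => hΛ _ hh)
  refine ⟨RealRMK.rieszMeasure L, inferInstance, fun h => ?_⟩
  exact RealRMK.integral_rieszMeasure L
    ⟨h, HasCompactSupport.of_compactSpace _⟩

theorem integrable_of_continuous {K : Type*} [TopologicalSpace K] [CompactSpace K]
    [MeasurableSpace K] [OpensMeasurableSpace K] (μ : Measure K)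
    [IsFiniteMeasure μ] {f : K → ℝ} (hf : Continuous f) : Integrable f μ :=
  hf.integrable_of_hasCompactSupport (HasCompactSupport.of_compactSpace f)

/-! ### The Kantorovich functional, couplings and dual values. -/

variable {X : Type*} [MeasurableSpace X]

/-- The Kantorovich functional `f ↦ ∫ f dP - ∫ f dQ`. -/
def meanGap (P Q : Measure X) (f : X → ℝ) : ℝ := (∫ x, f x ∂P) - ∫ x, f x ∂Q

theorem classLoss_eq_neg_meanGap (P Q : Measure X) (f : X → ℝ) :
    classLoss P Q f = -meanGap P Q f := by
  simp only [classLoss, wLoss, meanGap, neg_mul, one_mul, neg_neg, integral_neg]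
  ring

/-- The first marginal already fixes the total mass at 1. -/
theorem isFiniteMeasure_of_mem_couplings {P Q : Measure X} [IsProbabilityMeasure P]
    {π : Measure (X × X)} (hπ : π ∈ couplings P Q) : IsFiniteMeasure π := by
  refine ⟨?_⟩
  have h : π.map Prod.fst Set.univ = 1 := by rw [hπ.1]; exact measure_univ
  rw [Measure.map_apply measurable_fst MeasurableSet.univ, Set.preimage_univ] at h
  simp [h]

variable [MetricSpace X]

theorem continuous_of_mem_lip1 {Y : Type*} [PseudoEMetricSpace Y] {f : Y → ℝ} (hf : f ∈ lip1 Y) : Continuous f :=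
  LipschitzWith.continuous hf

/-- The zero competitor rules out a negative maximum, which `ENNReal.ofReal` would truncate. -/
theorem meanGap_nonneg_of_isMaxOn {P Q : Measure X} {f : X → ℝ}
    (hmax : IsMaxOn (meanGap P Q) (lip1 X) f) : 0 ≤ meanGap P Q f := by
  have h : meanGap P Q (fun _ => 0) ≤ meanGap P Q f :=
    hmax (show (fun _ => (0 : ℝ)) ∈ lip1 X from LipschitzWith.const' 0)
  simpa [meanGap] using h

/-- The values of the pairs of potentials whose sum dominates `h`. -/
def dualValues (P Q : Measure X) (h : C(X × X, ℝ)) : Set ℝ :=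
  {r | ∃ φ ψ : C(X, ℝ), (∀ x y, h (x, y) ≤ φ x + ψ y) ∧ r = (∫ x, φ x ∂P) + ∫ x, ψ x ∂Q}

theorem dualValues_nonempty [CompactSpace X] (P Q : Measure X)
    (h : C(X × X, ℝ)) : (dualValues P Q h).Nonempty :=
  ⟨_, ContinuousMap.const X ‖h‖, 0, fun x y => by
    simpa using (le_abs_self _).trans (h.norm_coe_le_norm (x, y)), rfl⟩

variable [BorelSpace X]

/-- Conditioning divides by the label's probability; the factor 1/2 undoes this. -/
theorem setIntegral_label_eq (μ : Measure (X × labels)) [IsProbabilityMeasure μ] {y : ℝ}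
    (hμ : μ {z | (z.2 : ℝ) = y} = 1 / 2) {f : X → ℝ} (hf : Continuous f) :
    ∫ z in {z | (z.2 : ℝ) = y}, f z.1 ∂μ = (1 / 2) * ∫ x, f x ∂(classLaw μ y) := by
  rw [classLaw, integral_map measurable_fst.aemeasurable hf.aestronglyMeasurable,
    ProbabilityTheory.cond, integral_smul_measure, hμ]
  simp

variable [CompactSpace X]

/-! ### Existence of a maximizer. -/

/-- Adding a constant does not change `meanGap`, as P and Q have equal mass. Normalizing f x₀ = 0
bounds f by the diameter, and the normalized `1`-Lipschitz functions form a compact set. -/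
theorem exists_isMaxOn_meanGap (P Q : Measure X) [IsProbabilityMeasure P]
    [IsProbabilityMeasure Q] :
    ∃ f ∈ lip1 X, IsMaxOn (meanGap P Q) (lip1 X) f := by
  obtain ⟨x₀⟩ : Nonempty X := nonempty_of_isProbabilityMeasure P
  let A : Set (BoundedContinuousFunction X ℝ) := {f | f x₀ = 0 ∧ LipschitzWith 1 f}
  have hA : IsCompact A := by
    refine BoundedContinuousFunction.arzela_ascoli₂
      (Metric.closedBall 0 (Metric.diam (Set.univ : Set X))) (isCompact_closedBall _ _) A ?_ ?_ ?_
    · have : A = {f | f x₀ = 0} ∩ ⋂ x, ⋂ y, {f | dist (f x) (f y) ≤ dist x y} := by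
        ext f
        simp [A, lipschitzWith_iff_dist_le_mul]
      rw [this]
      have hc : ∀ x : X, Continuous fun f : BoundedContinuousFunction X ℝ => f x :=
        fun x => continuous_eval_const x
      refine (isClosed_eq (hc x₀) continuous_const).inter
        (isClosed_iInter fun x => isClosed_iInter fun y => ?_)
      exact isClosed_le ((hc x).dist (hc y)) continuous_const
    · rintro f x ⟨h0, hf⟩
      rw [Metric.mem_closedBall, ← h0]
      refine (hf.dist_le_mul x x₀).trans ?_
      rw [NNReal.coe_one, one_mul]
      exact Metric.dist_le_diam_of_mem isCompact_univ.isBounded trivial trivial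
    · exact (LipschitzWith.uniformEquicontinuous _ 1 fun f : A => f.2.2).equicontinuous
  have hcont : Continuous fun f : BoundedContinuousFunction X ℝ => meanGap P Q f := by
    have key : ∀ (ρ : Measure X) [IsProbabilityMeasure ρ],
        Continuous fun f : BoundedContinuousFunction X ℝ => ∫ x, f x ∂ρ := by
      intro ρ _
      refine LipschitzWith.continuous (K := 1) (LipschitzWith.of_dist_le_mul fun f g => ?_)
      rw [dist_eq_norm, ← integral_sub (f.integrable ρ) (g.integrable ρ), NNReal.coe_one, one_mul,
        dist_eq_norm]
      exact (f - g).norm_integral_le_norm ρ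
    exact (key P).sub (key Q)
  obtain ⟨f, hfA, hf⟩ := hA.exists_isMaxOn ⟨0, rfl, by exact LipschitzWith.const' 0⟩
    hcont.continuousOn
  refine ⟨f, hfA.2, fun g hg => ?_⟩
  have hgc := continuous_of_mem_lip1 hg
  let g' : BoundedContinuousFunction X ℝ :=
    BoundedContinuousFunction.mkOfCompact ⟨fun x => g x - g x₀, hgc.sub continuous_const⟩
  have hg' : g' ∈ A := by
    refine ⟨sub_self _, ?_⟩
    refine LipschitzWith.of_dist_le_mul fun x y => ?_
    have := LipschitzWith.dist_le_mul hg x y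
    simpa [g', Real.dist_eq] using this
  have h := hf hg'
  have heq : meanGap P Q g' = meanGap P Q g := by
    have key : ∀ (ρ : Measure X) [IsProbabilityMeasure ρ],
        ∫ x, g' x ∂ρ = (∫ x, g x ∂ρ) - g x₀ := by
      intro ρ _
      change ∫ x, (g x - g x₀) ∂ρ = _
      rw [integral_sub (integrable_of_continuous ρ hgc) (integrable_const _)]
      simp
    simp only [meanGap, key P, key Q]
    ring
  change meanGap P Q g' ≤ meanGap P Q f at h
  change meanGap P Q g ≤ meanGap P Q f
  rwa [heq] at h

/-! ### Dual potentials and the construction of a coupling. -/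

/-- The `c`-transform: an admissible pair of potentials is improved by a `1`-Lipschitz function. -/
theorem exists_lip1_integral_add_le (P Q : Measure X) [IsProbabilityMeasure P]
    [IsProbabilityMeasure Q] (φ ψ : C(X, ℝ)) (h : ∀ x y, φ x + ψ y ≤ dist x y) :
    ∃ f ∈ lip1 X, (∫ x, φ x ∂P) + ∫ x, ψ x ∂Q ≤ meanGap P Q f := by
  obtain ⟨x₀⟩ : Nonempty X := nonempty_of_isProbabilityMeasure P
  have : Nonempty X := ⟨x₀⟩
  -- Without a lower bound the real infimum would take its default value 0; φ x supplies one.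
  have hb : ∀ x, BddBelow (Set.range fun y => dist x y - ψ y) := fun x =>
    ⟨φ x, by rintro _ ⟨y, rfl⟩; linarith [h x y]⟩
  let f : X → ℝ := fun x => ⨅ y, (dist x y - ψ y)
  have hf : f ∈ lip1 X := by
    refine LipschitzWith.of_le_add fun x x' => ?_
    rw [← sub_le_iff_le_add]
    refine le_ciInf fun y => ?_
    have h1 : f x ≤ dist x y - ψ y := ciInf_le (hb x) y
    linarith [dist_triangle x x' y]
  have hφ : ∀ x, φ x ≤ f x := fun x => le_ciInf fun y => by linarith [h x y]
  have hψ : ∀ y, f y ≤ -ψ y := fun y => by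
    have h1 : f y ≤ dist y y - ψ y := ciInf_le (hb y) y
    rw [dist_self] at h1
    linarith
  have hfc := continuous_of_mem_lip1 hf
  refine ⟨f, hf, ?_⟩
  have h1 : ∫ x, φ x ∂P ≤ ∫ x, f x ∂P := integral_mono
    (integrable_of_continuous P φ.continuous) (integrable_of_continuous P hfc) hφ
  have h2 : ∫ x, f x ∂Q ≤ ∫ x, -ψ x ∂Q := integral_mono
    (integrable_of_continuous Q hfc) (integrable_of_continuous Q ψ.continuous.neg) hψ
  rw [integral_neg] at h2
  unfold meanGap
  linarith

theorem le_of_mem_dualValues (P Q : Measure X) [IsProbabilityMeasure P] [IsProbabilityMeasure Q]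
    {h : C(X × X, ℝ)} {m r : ℝ} (hm : ∀ z, m ≤ h z) (hr : r ∈ dualValues P Q h) : m ≤ r := by
  obtain ⟨φ, ψ, hle, rfl⟩ := hr
  -- Integrate in x for fixed y, then in y: no product measure is needed.
  have h1 : ∀ y, m - ψ y ≤ ∫ x, φ x ∂P := fun y => by
    have := integral_mono (μ := P) (integrable_const (m - ψ y))
      (integrable_of_continuous P φ.continuous)
      (fun x => by change m - ψ y ≤ φ x; linarith [hle x y, hm (x, y)])
    simpa using this
  have h2 := integral_mono (μ := Q) ((integrable_const m).sub
    (integrable_of_continuous Q ψ.continuous)) (integrable_const (∫ x, φ x ∂P)) h1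
  rw [integral_sub' (integrable_const m) (integrable_of_continuous Q ψ.continuous)] at h2
  simp only [integral_const, probReal_univ, one_smul] at h2
  linarith

theorem bddBelow_dualValues (P Q : Measure X) [IsProbabilityMeasure P] [IsProbabilityMeasure Q]
    (h : C(X × X, ℝ)) : BddBelow (dualValues P Q h) :=
  ⟨-‖h‖, fun _ => le_of_mem_dualValues P Q fun z => neg_le_of_abs_le (h.norm_coe_le_norm z)⟩

theorem sInf_dualValues_add (P Q : Measure X) [IsProbabilityMeasure P] [IsProbabilityMeasure Q]
    (h k : C(X × X, ℝ)) :
    sInf (dualValues P Q (h + k)) ≤ sInf (dualValues P Q h) + sInf (dualValues P Q k) := by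
  rw [← sub_le_iff_le_add]
  refine le_csInf (dualValues_nonempty P Q h) fun r hr => ?_
  rw [sub_le_iff_le_add, ← sub_le_iff_le_add']
  refine le_csInf (dualValues_nonempty P Q k) fun s hs => ?_
  rw [sub_le_iff_le_add']
  refine csInf_le (bddBelow_dualValues P Q _) ?_
  obtain ⟨φ, ψ, h1, rfl⟩ := hr
  obtain ⟨φ', ψ', h2, rfl⟩ := hs
  refine ⟨φ + φ', ψ + ψ', fun x y => ?_, ?_⟩
  · simp only [ContinuousMap.add_apply]
    linarith [h1 x y, h2 x y]
  · simp only [ContinuousMap.add_apply]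
    rw [integral_add (integrable_of_continuous P φ.continuous)
      (integrable_of_continuous P φ'.continuous), integral_add
      (integrable_of_continuous Q ψ.continuous) (integrable_of_continuous Q ψ'.continuous)]
    ring

theorem sInf_dualValues_smul_le (P Q : Measure X) [IsProbabilityMeasure P]
    [IsProbabilityMeasure Q] {c : ℝ} (hc : 0 < c) (h : C(X × X, ℝ)) :
    sInf (dualValues P Q (c • h)) ≤ c * sInf (dualValues P Q h) := by
  rw [← div_le_iff₀' hc]
  refine le_csInf (dualValues_nonempty P Q h) fun r hr => ?_
  rw [div_le_iff₀' hc]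
  refine csInf_le (bddBelow_dualValues P Q _) ?_
  obtain ⟨φ, ψ, h1, rfl⟩ := hr
  refine ⟨c • φ, c • ψ, fun x y => ?_, ?_⟩
  · simp only [ContinuousMap.smul_apply, smul_eq_mul, ← mul_add]
    exact mul_le_mul_of_nonneg_left (h1 x y) hc.le
  · simp only [ContinuousMap.smul_apply, smul_eq_mul, integral_const_mul, mul_add]

theorem sInf_dualValues_smul (P Q : Measure X) [IsProbabilityMeasure P] [IsProbabilityMeasure Q]
    {c : ℝ} (hc : 0 < c) (h : C(X × X, ℝ)) :
    sInf (dualValues P Q (c • h)) = c * sInf (dualValues P Q h) := by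
  refine (sInf_dualValues_smul_le P Q hc h).antisymm ?_
  -- The reverse inequality is the same bound for the scalar c⁻¹ at c • h.
  have := sInf_dualValues_smul_le P Q (inv_pos.2 hc) (c • h)
  rwa [inv_smul_smul₀ hc.ne', ← div_eq_inv_mul, le_div_iff₀' hc] at this

/-- Some coupling has mean distance at most the maximum of the Kantorovich functional. -/
theorem exists_coupling_integral_dist_le [SecondCountableTopology X] (P Q : Measure X)
    [IsProbabilityMeasure P] [IsProbabilityMeasure Q] {J : ℝ}
    (hJ : ∀ f ∈ lip1 X, meanGap P Q f ≤ J) :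
    ∃ π ∈ couplings P Q, IsFiniteMeasure π ∧ ∫ z, dist z.1 z.2 ∂π ≤ J := by
  let d : C(X × X, ℝ) := ⟨fun z => dist z.1 z.2, continuous_dist⟩
  obtain ⟨Λ, hΛd, hΛ⟩ := exists_linearMap_le_sublinear_eq (fun h => sInf (dualValues P Q h))
    (fun c hc h => sInf_dualValues_smul P Q hc h) (sInf_dualValues_add P Q) (-d)
  have hΛle : ∀ h : C(X × X, ℝ), ∀ r ∈ dualValues P Q h, Λ h ≤ r := fun h r hr =>
    (hΛ h).trans (csInf_le (bddBelow_dualValues P Q h) hr)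
  obtain ⟨π, hπ, hint⟩ := exists_measure_integral_eq_of_nonneg Λ (by
    intro h hh
    -- The zero potentials dominate -h, so Λ (-h) ≤ 0.
    have := hΛle (-h) 0 ⟨0, 0, fun x y => by simpa using hh (x, y), by simp⟩
    rw [map_neg] at this
    linarith)
  have hfst : ∀ f : C(X, ℝ), Λ ⟨fun z => f z.1, by fun_prop⟩ = ∫ x, f x ∂P := by
    intro f
    -- A function of one coordinate is its own potential, and so is its negative; the two bounds
    -- force equality.
    have h1 := hΛle ⟨fun z => f z.1, by fun_prop⟩ _ ⟨f, 0, fun x y => by simp, rfl⟩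
    have h2 := hΛle (-⟨fun z => f z.1, by fun_prop⟩) _ ⟨-f, 0, fun x y => by simp, rfl⟩
    rw [map_neg] at h2
    simp [integral_neg] at h1 h2
    exact h1.antisymm h2
  have hsnd : ∀ f : C(X, ℝ), Λ ⟨fun z => f z.2, by fun_prop⟩ = ∫ x, f x ∂Q := by
    intro f
    have h1 := hΛle ⟨fun z => f z.2, by fun_prop⟩ _ ⟨0, f, fun x y => by simp, rfl⟩
    have h2 := hΛle (-⟨fun z => f z.2, by fun_prop⟩) _ ⟨0, -f, fun x y => by simp, rfl⟩
    rw [map_neg] at h2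
    simp [integral_neg] at h1 h2
    exact h1.antisymm h2
  refine ⟨π, ⟨?_, ?_⟩, hπ, ?_⟩
  · refine ext_of_forall_integral_eq_of_IsFiniteMeasure fun f => ?_
    rw [integral_map measurable_fst.aemeasurable f.continuous.aestronglyMeasurable]
    exact (hint ⟨fun z => f z.1, by fun_prop⟩).trans (hfst f.toContinuousMap)
  · refine ext_of_forall_integral_eq_of_IsFiniteMeasure fun f => ?_
    rw [integral_map measurable_snd.aemeasurable f.continuous.aestronglyMeasurable]
    exact (hint ⟨fun z => f z.2, by fun_prop⟩).trans (hsnd f.toContinuousMap)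
  · have h1 : ∫ z, dist z.1 z.2 ∂π = Λ d := hint d
    have h2 : -J ≤ Λ (-d) := by
      rw [hΛd]
      refine le_csInf (dualValues_nonempty P Q _) ?_
      rintro r ⟨φ, ψ, hle, rfl⟩
      -- Since φ + ψ dominates -d, the pair (-φ, -ψ) is admissible for the distance.
      obtain ⟨f, hf, hfle⟩ := exists_lip1_integral_add_le P Q (-φ) (-ψ) (fun x y => by
        have := hle x y
        simp only [ContinuousMap.neg_apply, d, ContinuousMap.coe_mk] at this ⊢
        linarith)
      have := hJ f hf
      simp only [ContinuousMap.neg_apply, integral_neg] at hfle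
      linarith
    rw [map_neg] at h2
    linarith

/-! ### Kantorovich–Rubinstein duality. -/

theorem lintegral_edist_eq_ofReal [SecondCountableTopology X] (π : Measure (X × X))
    [IsFiniteMeasure π] :
    ∫⁻ z, edist z.1 z.2 ∂π = ENNReal.ofReal (∫ z, dist z.1 z.2 ∂π) := by
  rw [ofReal_integral_eq_lintegral_ofReal (integrable_of_continuous π continuous_dist)
    (Filter.Eventually.of_forall fun _ => dist_nonneg)]
  simp only [edist_dist]

theorem meanGap_le_integral_dist [SecondCountableTopology X] {P Q : Measure X}
    [IsProbabilityMeasure P] {π : Measure (X × X)} [IsFiniteMeasure π] (hπ : π ∈ couplings P Q)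
    {f : X → ℝ} (hf : f ∈ lip1 X) : meanGap P Q f ≤ ∫ z, dist z.1 z.2 ∂π := by
  have hfc := continuous_of_mem_lip1 hf
  have h1 : Integrable (fun z : X × X => f z.1) π :=
    integrable_of_continuous π (hfc.comp continuous_fst)
  have h2 : Integrable (fun z : X × X => f z.2) π :=
    integrable_of_continuous π (hfc.comp continuous_snd)
  unfold meanGap
  rw [← hπ.1, ← hπ.2, integral_map measurable_fst.aemeasurable hfc.aestronglyMeasurable,
    integral_map measurable_snd.aemeasurable hfc.aestronglyMeasurable,
    ← integral_sub h1 h2]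
  refine integral_mono (h1.sub h2) (integrable_of_continuous π continuous_dist) fun z => ?_
  have := LipschitzWith.dist_le_mul hf z.1 z.2
  rw [NNReal.coe_one, one_mul, Real.dist_eq] at this
  exact (le_abs_self _).trans this

/-- **Kantorovich–Rubinstein duality** on a compact metric space. -/
theorem wasserstein1_eq_ofReal_meanGap [SecondCountableTopology X] (P Q : Measure X)
    [IsProbabilityMeasure P] [IsProbabilityMeasure Q] {f : X → ℝ} (hf : f ∈ lip1 X)
    (hmax : IsMaxOn (meanGap P Q) (lip1 X) f) :
    wasserstein1 P Q = ENNReal.ofReal (meanGap P Q f) := by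
  obtain ⟨π, hπ, _, hle⟩ := exists_coupling_integral_dist_le P Q (J := meanGap P Q f)
    fun g hg => hmax hg
  refine le_antisymm ?_ (le_iInf₂ fun ρ hρ => ?_)
  · refine (iInf₂_le π hπ).trans ?_
    rw [lintegral_edist_eq_ofReal]
    exact ENNReal.ofReal_le_ofReal hle
  · have := isFiniteMeasure_of_mem_couplings hρ
    rw [lintegral_edist_eq_ofReal]
    exact ENNReal.ofReal_le_ofReal (meanGap_le_integral_dist hρ hf)

theorem isGreatest_meanGap [SecondCountableTopology X] (P Q : Measure X)
    [IsProbabilityMeasure P] [IsProbabilityMeasure Q] :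
    wasserstein1 P Q ≠ ⊤ ∧ IsGreatest (meanGap P Q '' lip1 X) (wasserstein1 P Q).toReal := by
  obtain ⟨f, hf, hmax⟩ := exists_isMaxOn_meanGap P Q
  rw [wasserstein1_eq_ofReal_meanGap P Q hf hmax,
    ENNReal.toReal_ofReal (meanGap_nonneg_of_isMaxOn hmax)]
  refine ⟨ENNReal.ofReal_ne_top, ⟨f, hf, rfl⟩, ?_⟩
  rintro _ ⟨g, hg, rfl⟩
  exact hmax hg

/-! ### Robustness and losses in terms of the Kantorovich functional. -/

theorem mcr_eq_integral (P : Measure X) [IsProbabilityMeasure P] {y : ℝ} (hy : |y| = 1)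
    {f : X → ℝ} (hf : Continuous f) : mcr P y f = ∫ x, y * f x ∂P := by
  have habs : Integrable (fun x => |f x|) P := integrable_of_continuous P hf.abs
  have hyf : Measurable fun x => y * f x := (hf.const_smul y).measurable
  unfold mcr
  rw [← integral_add (g := fun x => -Set.indicator {x | y * f x < 0} (fun x => |f x|) x)
    (habs.indicator (measurableSet_lt measurable_const hyf))
    (habs.indicator (measurableSet_lt hyf measurable_const)).neg]
  refine integral_congr_ae (Filter.Eventually.of_forall fun x => ?_)
  have h : |f x| = |y * f x| := by rw [abs_mul, hy, one_mul]
  simp only [Set.indicator_apply, Set.mem_ofPred_eq, h]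
  rcases lt_trichotomy (y * f x) 0 with h0 | h0 | h0
  · simp [h0, h0.not_gt, abs_of_neg h0]
  · simp [h0]
  · simp [h0, h0.not_gt, abs_of_pos h0]

theorem totalMcr_eq_meanGap (P Q : Measure X) [IsProbabilityMeasure P] [IsProbabilityMeasure Q]
    {f : X → ℝ} (hf : f ∈ lip1 X) : totalMcr P Q f = meanGap P Q f := by
  have hc := continuous_of_mem_lip1 hf
  rw [totalMcr, mcr_eq_integral P (by simp) hc, mcr_eq_integral Q (by simp) hc, meanGap]
  simp [integral_neg, sub_eq_add_neg]

/-- The two label events are complementary, so each has mass 1/2; on them the loss is -f and f. -/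
theorem expectedLoss_eq_neg_meanGap (μ : Measure (X × labels)) [IsProbabilityMeasure μ]
    (hμ : μ {z | (z.2 : ℝ) = 1} = 1 / 2) {f : X → ℝ} (hf : Continuous f) :
    expectedLoss μ f = -((1 / 2) * meanGap (classLaw μ 1) (classLaw μ (-1)) f) := by
  have hlab : Measurable fun z : X × labels => (z.2 : ℝ) := measurable_snd.subtype_val
  have hm : ∀ y : ℝ, MeasurableSet {z : X × labels | (z.2 : ℝ) = y} := fun y =>
    hlab (measurableSet_singleton y)
  have hcompl : {z : X × labels | (z.2 : ℝ) = 1}ᶜ = {z | (z.2 : ℝ) = -1} := by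
    ext z
    simp only [Set.mem_compl_iff, Set.mem_ofPred_eq]
    rcases z.2.2 with h | h
    · rw [h]; norm_num
    · rw [Set.mem_singleton_iff] at h; rw [h]; norm_num
  have hμ' : μ {z | (z.2 : ℝ) = -1} = 1 / 2 := by
    rw [← hcompl, prob_compl_eq_one_sub (hm 1), hμ, one_div, ENNReal.one_sub_inv_two]
  obtain ⟨C, hC⟩ := (isCompact_range hf).isBounded.exists_norm_le
  have hint : Integrable (fun z : X × labels => wLoss (f z.1) z.2) μ := by
    refine Integrable.of_bound (C := C)
      ((hlab.neg.mul (hf.measurable.comp measurable_fst)).aestronglyMeasurable)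
      (Filter.Eventually.of_forall fun z => ?_)
    have h1 : |(z.2 : ℝ)| = 1 := by
      rcases z.2.2 with h | h
      · rw [h]; simp
      · rw [Set.mem_singleton_iff] at h; rw [h]; simp
    rw [wLoss, norm_mul, norm_neg, Real.norm_eq_abs, h1, one_mul]
    exact hC _ ⟨z.1, rfl⟩
  unfold expectedLoss
  rw [← integral_add_compl (hm 1) hint, hcompl,
    setIntegral_congr_fun (g := fun z => -f z.1) (hm 1) (fun z hz => by
      change -(z.2 : ℝ) * f z.1 = _
      rw [show (z.2 : ℝ) = 1 from hz]; ring),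
    setIntegral_congr_fun (g := fun z => f z.1) (hm (-1)) (fun z hz => by
      change -(z.2 : ℝ) * f z.1 = _
      rw [show (z.2 : ℝ) = -1 from hz]; ring),
    integral_neg, setIntegral_label_eq μ hμ hf, setIntegral_label_eq μ hμ' hf, meanGap]
  ring

/-! ### Transfer of extrema between proportional functionals. -/

/-- If `G = -c F` on `s` with `c > 0`, the greatest value of `F` gives the least value of `G`. -/
theorem isLeast_image_of_eq_neg_mul {α : Type*} {s : Set α} {F G : α → ℝ} {c M : ℝ} (hc : 0 < c)
    (hFG : ∀ a ∈ s, G a = -(c * F a)) (h : IsGreatest (F '' s) M) :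
    IsLeast (G '' s) (-(c * M)) := by
  obtain ⟨⟨a, ha, rfl⟩, hub⟩ := h
  refine ⟨⟨a, ha, hFG a ha⟩, ?_⟩
  rintro _ ⟨b, hb, rfl⟩
  rw [hFG b hb]
  exact neg_le_neg (mul_le_mul_of_nonneg_left (hub ⟨b, hb, rfl⟩) hc.le)

theorem isMaxOn_iff_isMinOn_of_eq_neg_mul {α : Type*} {s : Set α} {F G : α → ℝ} {c : ℝ}
    (hc : 0 < c) (hFG : ∀ a ∈ s, G a = -(c * F a)) {a : α} (ha : a ∈ s) :
    IsMaxOn F s a ↔ IsMinOn G s a := by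
  rw [isMaxOn_iff, isMinOn_iff]
  refine forall₂_congr fun b hb => ?_
  rw [hFG a ha, hFG b hb, neg_le_neg_iff, mul_le_mul_iff_right₀ hc]

end LipClass

end

theorem mainTheorem2 (n : ℕ) (X : Set (EuclideanSpace ℝ (Fin n))) (hX : IsCompact X)
    (P Q : Measure X) (hP : IsProbabilityMeasure P) (hQ : IsProbabilityMeasure Q) :
    LipClass.wasserstein1 P Q ≠ ⊤ ∧
    IsGreatest (LipClass.totalMcr P Q '' LipClass.lip1 X) (LipClass.wasserstein1 P Q).toReal ∧
    IsLeast (LipClass.classLoss P Q '' LipClass.lip1 X) (-(LipClass.wasserstein1 P Q).toReal) ∧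
    (∀ f ∈ LipClass.lip1 X,
      IsMaxOn (LipClass.totalMcr P Q) (LipClass.lip1 X) f ↔
        IsMinOn (LipClass.classLoss P Q) (LipClass.lip1 X) f) ∧
    (∀ μ : Measure (X × LipClass.labels), IsProbabilityMeasure μ →
      μ {z | (z.2 : ℝ) = 1} = 1 / 2 →
      LipClass.classLaw μ 1 = P → LipClass.classLaw μ (-1) = Q →
      IsLeast (LipClass.expectedLoss μ '' LipClass.lip1 X)
          (-((LipClass.wasserstein1 P Q).toReal / 2)) ∧
        ∀ f ∈ LipClass.lip1 X,
          IsMaxOn (LipClass.totalMcr P Q) (LipClass.lip1 X) f ↔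
            IsMinOn (LipClass.expectedLoss μ) (LipClass.lip1 X) f) := by
  have : CompactSpace X := isCompact_iff_compactSpace.1 hX
  obtain ⟨hfin, hgap⟩ := LipClass.isGreatest_meanGap P Q
  have htot : IsGreatest (LipClass.totalMcr P Q '' LipClass.lip1 X)
      (LipClass.wasserstein1 P Q).toReal := by
    rwa [Set.image_congr fun f hf => LipClass.totalMcr_eq_meanGap P Q hf]
  -- The scale is c = 1 here and c = 1/2 for the balanced joint law below.
  have hclass : ∀ f ∈ LipClass.lip1 X,
      LipClass.classLoss P Q f = -(1 * LipClass.totalMcr P Q f) := fun f hf => by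
    rw [LipClass.classLoss_eq_neg_meanGap, LipClass.totalMcr_eq_meanGap P Q hf, one_mul]
  refine ⟨hfin, htot, ?_, fun f hf =>
    LipClass.isMaxOn_iff_isMinOn_of_eq_neg_mul one_pos hclass hf, ?_⟩
  · simpa only [one_mul] using LipClass.isLeast_image_of_eq_neg_mul one_pos hclass htot
  · intro μ _ hμ hμP hμQ
    have hexp : ∀ f ∈ LipClass.lip1 X,
        LipClass.expectedLoss μ f = -((1 / 2) * LipClass.totalMcr P Q f) := fun f hf => by
      rw [LipClass.expectedLoss_eq_neg_meanGap μ hμ (LipClass.continuous_of_mem_lip1 hf),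
        hμP, hμQ, LipClass.totalMcr_eq_meanGap P Q hf]
    refine ⟨?_, fun f hf =>
      LipClass.isMaxOn_iff_isMinOn_of_eq_neg_mul one_half_pos hexp hf⟩
    rw [div_eq_inv_mul, ← one_div]
    exact LipClass.isLeast_image_of_eq_neg_mul one_half_pos hexp htot
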